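/- Let $\Gamma$ be a connected graph in the sense of Serre, with terminus map $t$, origin map $o$ and edge reversal $e\mapsto\bar e$ ($\bar e\neq e$, $\bar{\bar e}=e$, $t(\bar e)=o(e)$). Let $\mathcal G(\Gamma)$ be a graph of groupoids on $\Gamma$: vertex groupoids $\mathcal G_v$ ($v\in\Gamma^0$), edge groupoids $\mathcal G_e=\mathcal G_{\bar e}$ ($e\in\Gamma^1$), and injective groupoid homomorphisms $\alpha_e\colon\mathcal G_e\to\mathcal G_{t(e)}$ whose images $\mathcal H_e=\alpha_e(\mathcal G_e)$ are wide subgroupoids of $\mathcal G_{t(e)}$ (that is, they contain all its units). Put $\phi_e=\alpha_e\circ\alpha_{\bar e}^{-1}\colon\mathcal H_{\bar e}\to\mathcal H_e$. In a groupoid, $r(g)$ and $s(g)$ denote the range and the source of $g$, and $gh$ is defined when $s(g)=r(h)$. Let $\mathcal F(\mathcal G(\Gamma))$ be the groupoid with set of units $\bigsqcup_{v\in\Gamma^0}\mathcal G_v^{(0)}$ that is presented by the following generators and relations. The generators are the elements of all vertex groupoids, with their range and source, and the symbols $(\phi_e(x),x)$ for $e\in\Gamma^1$ and $x\in\mathcal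 G_{o(e)}^{(0)}$, with range $\phi_e(x)$ and source $x$ (there is one such symbol for each pair $e$, $x$). The relations are those of the vertex groupoids, and $$(\alpha_e(r(g)),\alpha_{\bar e}(r(g)))\cdot\alpha_{\bar e}(g)\cdot(\alpha_{\bar e}(s(g)),\alpha_e(s(g)))=\alpha_e(g)\qquad(e\in\Gamma^1,\ g\in\mathcal G_e),\tag{R2}$$ where the first factor is the symbol of the edge $e$ and the third one is the symbol of the edge $\bar e$. A graph of groupoids word is a sequence $w=g_1e_1g_2e_2\cdots g_ne_ng_{n+1}$ with $n\ge 0$, $e_i\in\Gamma^1$, $o(e_i)=t(e_{i+1})$ for $1\le i<n$, $g_i\in\mathcal G_{t(e_i)}$ and $s(g_i)=\phi_{e_i}(r(g_{i+1}))$ for $1\le i\le n$, and $g_{n+1}\in\mathcal G_{o(e_n)}$ (for $n=0$, $w=g_1$ is an element of some vertex groupoid). It represents the element $$g_1\cdot(s(g_1),r(g_2))\cdot g_2\cdots g_n\cdot(s(g_n),r(g_{n+1}))\cdot g_{n+1}$$ of $\mathcal F(\mathcal G(\Gamma))$, where $(s(g_i),r(g_{i+1}))$ is the symbol of the edge $e_i$.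 For each $e\in\Gamma^1$ let $\mathcal T_e\subseteq\mathcal G_{t(e)}$ be a left transversal of $\mathcal H_e$ in $\mathcal G_{t(e)}$ (a set that contains exactly one element of each coset $g\mathcal H_e$) that contains the units of $\mathcal G_{t(e)}$. The word $w$ is called reduced if $g_i\in\mathcal T_{e_i}$ for all $1\le i\le n$ and, for all $2\le i\le n$ with $\bar e_i=e_{i-1}$, one has $g_i\notin\mathcal H_{e_i}$. Theorem. For every choice of the transversals $\mathcal T_e$ ($e\in\Gamma^1$), every morphism of $\mathcal F(\mathcal G(\Gamma))$ is represented by exactly one reduced graph of groupoids word. -/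

import Mathlib

open CategoryTheory

universe uV uE v₁ u₁ v₂ u₂

set_option linter.checkUnivs false

/-- A graph in the sense of Serre: a non-empty set `V` of vertices, a set `E` of edges, a terminus
map `t`, and a fixed point free involution `rev` of the edges (written `ē` in comments). As the
origin of `e` has to be the terminus of `ē`, it is defined that way. -/
structure SerreGraph (V : Type uV) (E : Type uE) where
  t : E → V
  rev : E → E
  rev_ne : ∀ e, rev e ≠ e
  rev_rev : ∀ e, rev (rev e) = e
  nonempty : Nonempty V

namespace SerreGraph

variable {V : Type uV} {E : Type uE} (Γ : SerreGraph V E)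

/-- The origin of an edge. -/
abbrev o (e : E) : V := Γ.t (Γ.rev e)

/-- `Γ.IsPath v p w`: the sequence of edges `p = e₁ ⋯ eₙ` is a path from `v` to `w`, that is
`t(e₁) = v`, `o(eᵢ) = t(eᵢ₊₁)` and `o(eₙ) = w` (and `v = w` if `n = 0`). -/
def IsPath : V → List E → V → Prop
  | v, [], w => v = w
  | v, e :: p, w => Γ.t e = v ∧ IsPath (Γ.o e) p w

/-- A sequence of edges without backtracking: `eᵢ₊₁ ≠ ēᵢ` for all `i`. -/
def NoBacktracking (p : List E) : Prop := p.IsChain fun e f => f ≠ Γ.rev e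

/-- Any two vertices are joined by a path without backtracking. -/
def Connected : Prop := ∀ v w, ∃ p, Γ.IsPath v p w ∧ Γ.NoBacktracking p

end SerreGraph

/-- Two equal groupoids are identified through the identity functor. -/
def grpdCast {C D : Grpd.{v₂, u₂}} (h : C = D) : C ⥤ D := by
  cases h
  exact 𝟭 _

/-- A graph of groupoids on the connected graph `Γ`: vertex groupoids `𝒢ᵥ`, edge groupoids with
`𝒢_ē = 𝒢ₑ`, and injective homomorphisms `αₑ : 𝒢ₑ → 𝒢_{t(e)}` whose images are wide subgroupoids.
A homomorphism is injective (on arrows) when it is injective on units and faithful.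

Convention: for units `x`, `y` of a groupoid, `x ⟶ y` is the set of its elements `g` with
range `r(g) = x` and source `s(g) = y`. So the product `g h`, which is defined when
`s(g) = r(h)`, is `g ≫ h`. -/
structure GraphOfGroupoids {V : Type uV} {E : Type uE} (Γ : SerreGraph V E) where
  connected : Γ.Connected
  vert : V → Grpd.{v₁, u₁}
  edge : E → Grpd.{v₂, u₂}
  edge_rev : ∀ e, edge (Γ.rev e) = edge e
  α : ∀ e, edge e ⥤ vert (Γ.t e)
  α_inj : ∀ e, Function.Injective (α e).obj
  α_faithful : ∀ e, (α e).Faithful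
  α_wide : ∀ e, (Subgroupoid.im (α e) (α_inj e)).IsWide

namespace GraphOfGroupoids

variable {V : Type uV} {E : Type uE} {Γ : SerreGraph V E}
  (𝒢 : GraphOfGroupoids.{uV, uE, v₁, u₁, v₂, u₂} Γ)

/-- The subgroupoid `ℋₑ = αₑ(𝒢ₑ)` of `𝒢_{t(e)}`. -/
def H (e : E) : Subgroupoid (𝒢.vert (Γ.t e)) := Subgroupoid.im (𝒢.α e) (𝒢.α_inj e)

/-- The homomorphism `α_ē`, seen as a homomorphism `𝒢ₑ = 𝒢_ē → 𝒢_{o(e)}`. -/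
def αbar (e : E) : 𝒢.edge e ⥤ 𝒢.vert (Γ.o e) :=
  grpdCast (𝒢.edge_rev e).symm ⋙ 𝒢.α (Γ.rev e)

/-- The disjoint union of the sets of units of the vertex groupoids. -/
@[ext]
structure UnitPt where
  vertex : V
  pt : 𝒢.vert vertex

/-- `𝒢.PhiRel e y x` says that `x` is a unit of `𝒢_{o(e)}`, `y` is a unit of `𝒢_{t(e)}`, and
`y = φₑ(x)`, where `φₑ = αₑ ∘ α_ē⁻¹`. -/
def PhiRel (e : E) (y x : 𝒢.UnitPt) : Prop :=
  ∃ z : 𝒢.edge e, y = ⟨Γ.t e, (𝒢.α e).obj z⟩ ∧ x = ⟨Γ.o e, (𝒢.αbar e).obj z⟩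

theorem phiRel_α (e : E) (z : 𝒢.edge e) :
    𝒢.PhiRel e ⟨Γ.t e, (𝒢.α e).obj z⟩ ⟨Γ.o e, (𝒢.αbar e).obj z⟩ := ⟨z, rfl, rfl⟩

theorem unitPt_cast {e f : E} (h : f = e) (hG : 𝒢.edge e = 𝒢.edge f) (z : 𝒢.edge e) :
    (⟨Γ.t e, (𝒢.α e).obj z⟩ : 𝒢.UnitPt) =
      ⟨Γ.t f, (𝒢.α f).obj ((grpdCast hG).obj z)⟩ := by
  subst h
  rfl

theorem grpdCast_obj_trans {A B C : Grpd.{v₂, u₂}} (h : A = B) (k : B = C) (z : A) :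
    (grpdCast k).obj ((grpdCast h).obj z) = (grpdCast (h.trans k)).obj z := by
  subst h
  subst k
  rfl

/-- `φ_ē = φₑ⁻¹` on units. -/
theorem PhiRel.symm {e : E} {y x : 𝒢.UnitPt} (h : 𝒢.PhiRel e y x) :
    𝒢.PhiRel (Γ.rev e) x y := by
  obtain ⟨z, rfl, rfl⟩ := h
  refine ⟨(grpdCast (𝒢.edge_rev e).symm).obj z, rfl, ?_⟩
  simp only [αbar, Functor.comp_obj, grpdCast_obj_trans]
  exact 𝒢.unitPt_cast (Γ.rev_rev e) _ z

/-- The generators of the free groupoid: the elements of the vertex groupoids and the symbols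
`(φₑ(x), x)` for an edge `e` and a unit `x` of `𝒢_{o(e)}`, with their ranges and sources. -/
inductive Gen : 𝒢.UnitPt → 𝒢.UnitPt → Type (max uV uE v₁ u₁)
  | vert {v : V} {x y : 𝒢.vert v} (g : x ⟶ y) : Gen ⟨v, x⟩ ⟨v, y⟩
  | edge (e : E) {y x : 𝒢.UnitPt} (h : 𝒢.PhiRel e y x) : Gen y x

instance : Quiver 𝒢.UnitPt := ⟨𝒢.Gen⟩

/-- The generator given by an element of a vertex groupoid, in the free groupoid on the quiver of
generators. -/
def genVert {v : V} {x y : 𝒢.vert v} (g : x ⟶ y) :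
    (Quiver.FreeGroupoid.of 𝒢.UnitPt).obj ⟨v, x⟩ ⟶
      (Quiver.FreeGroupoid.of 𝒢.UnitPt).obj ⟨v, y⟩ :=
  (Quiver.FreeGroupoid.of 𝒢.UnitPt).map (Gen.vert g)

/-- The generator `(φₑ(x), x)` in the free groupoid on the quiver of generators. -/
def genEdge (e : E) {y x : 𝒢.UnitPt} (h : 𝒢.PhiRel e y x) :
    (Quiver.FreeGroupoid.of 𝒢.UnitPt).obj y ⟶ (Quiver.FreeGroupoid.of 𝒢.UnitPt).obj x :=
  (Quiver.FreeGroupoid.of 𝒢.UnitPt).map (Gen.edge e h)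

/-- The defining relations: those of the vertex groupoids, and for each `g` in an edge groupoid
`𝒢ₑ` the relation `(αₑ(r(g)), α_ē(r(g))) · α_ē(g) · (α_ē(s(g)), αₑ(s(g))) = αₑ(g)`, whose third
factor is a generator of the edge `ē`. -/
inductive Rel : HomRel (Quiver.FreeGroupoid 𝒢.UnitPt)
  | vert_id {v : V} (x : 𝒢.vert v) : Rel (𝒢.genVert (𝟙 x)) (𝟙 _)
  | vert_comp {v : V} {x y z : 𝒢.vert v} (g : x ⟶ y) (h : y ⟶ z) :
      Rel (𝒢.genVert g ≫ 𝒢.genVert h) (𝒢.genVert (g ≫ h))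
  | edge (e : E) {a b : 𝒢.edge e} (g : a ⟶ b) :
      Rel (𝒢.genEdge e (𝒢.phiRel_α e a) ≫ 𝒢.genVert ((𝒢.αbar e).map g) ≫
            𝒢.genEdge (Γ.rev e) (PhiRel.symm 𝒢 (𝒢.phiRel_α e b)))
        (𝒢.genVert ((𝒢.α e).map g))

/-- The groupoid `ℱ(𝒢(Γ))`, presented by the above generators and relations. -/
abbrev F := CategoryTheory.Quotient 𝒢.Rel

/-- The unit of `ℱ(𝒢(Γ))` given by a unit of a vertex groupoid. -/
def unit (x : 𝒢.UnitPt) : 𝒢.F :=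
  (Quotient.functor 𝒢.Rel).obj ((Quiver.FreeGroupoid.of 𝒢.UnitPt).obj x)

/-- The units of `ℱ(𝒢(Γ))` are exactly the units of the vertex groupoids. -/
theorem unit_bijective : Function.Bijective 𝒢.unit := by
  refine ⟨fun x y h => ?_, fun a => ⟨a.as.as, rfl⟩⟩
  exact congrArg (fun a : 𝒢.F => (a.as.as : 𝒢.UnitPt)) h

/-- The class in `ℱ(𝒢(Γ))` of an element of a vertex groupoid. -/
def ofVert {v : V} {x y : 𝒢.vert v} (g : x ⟶ y) : 𝒢.unit ⟨v, x⟩ ⟶ 𝒢.unit ⟨v, y⟩ :=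
  (Quotient.functor 𝒢.Rel).map (𝒢.genVert g)

/-- The class in `ℱ(𝒢(Γ))` of the generator `(φₑ(x), x)`. -/
def ofEdge (e : E) {y x : 𝒢.UnitPt} (h : 𝒢.PhiRel e y x) : 𝒢.unit y ⟶ 𝒢.unit x :=
  (Quotient.functor 𝒢.Rel).map (𝒢.genEdge e h)

/-- Graph of groupoids words `g₁ e₁ g₂ e₂ ⋯ gₙ eₙ gₙ₊₁` (`n ≥ 0`) with given range `r(g₁)` and
source `s(gₙ₊₁)`: one has `gᵢ ∈ 𝒢_{t(eᵢ)}` for `i ≤ n`, and `s(gᵢ) = φ_{eᵢ}(r(gᵢ₊₁))`, which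
includes that `gᵢ₊₁` lies in `𝒢_{o(eᵢ)}` and that `o(eᵢ) = t(eᵢ₊₁)`. -/
inductive Word : 𝒢.UnitPt → 𝒢.UnitPt → Type (max uV uE v₁ u₁)
  | nil {v : V} {x y : 𝒢.vert v} (g : x ⟶ y) : Word ⟨v, x⟩ ⟨v, y⟩
  | cons (e : E) {x y : 𝒢.vert (Γ.t e)} (g : x ⟶ y) {y' z : 𝒢.UnitPt}
      (h : 𝒢.PhiRel e ⟨Γ.t e, y⟩ y') (w : Word y' z) : Word ⟨Γ.t e, x⟩ z

/-- The element of `ℱ(𝒢(Γ))` represented by a word. -/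
def Word.toHom {𝒢 : GraphOfGroupoids.{uV, uE, v₁, u₁, v₂, u₂} Γ} :
    {x z : 𝒢.UnitPt} → 𝒢.Word x z → (𝒢.unit x ⟶ 𝒢.unit z)
  | _, _, .nil g => 𝒢.ofVert g
  | _, _, .cons e g h w => 𝒢.ofVert g ≫ 𝒢.ofEdge e h ≫ w.toHom

/-- A left transversal of `ℋₑ` in `𝒢_{t(e)}` containing the identity elements: a set of elements
of `𝒢_{t(e)}` that meets each coset `g ℋₑ` in exactly one element `τ`. -/
structure LeftTransversal (e : E) where
  carrier : ∀ x y : 𝒢.vert (Γ.t e), Set (x ⟶ y)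
  id_mem : ∀ x, 𝟙 x ∈ carrier x x
  existsUnique_coset : ∀ {x y : 𝒢.vert (Γ.t e)} (g : x ⟶ y),
    ∃! τ : Σ y' : 𝒢.vert (Γ.t e), (x ⟶ y'),
      τ.2 ∈ carrier x τ.1 ∧ ∃ h ∈ (𝒢.H e).arrows τ.1 y, g = τ.2 ≫ h

/-- If the word is `g₁ e₁ g₂ ⋯` of positive length and `ē₁ = e`, then `g₁ ∉ im(α_{e₁})`. -/
def Word.FirstAfter {𝒢 : GraphOfGroupoids.{uV, uE, v₁, u₁, v₂, u₂} Γ} (e : E) :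
    {x z : 𝒢.UnitPt} → 𝒢.Word x z → Prop
  | _, _, .nil _ => True
  | _, _, .cons f g _ _ => Γ.rev f = e → g ∉ (𝒢.H f).arrows _ _

/-- Reduced words: `gᵢ ∈ 𝒯_{eᵢ}` for `i ≤ n`, and `gᵢ ∉ im(α_{eᵢ})` whenever `ēᵢ = eᵢ₋₁`. -/
def Word.IsReduced {𝒢 : GraphOfGroupoids.{uV, uE, v₁, u₁, v₂, u₂} Γ}
    (T : ∀ e, 𝒢.LeftTransversal e) : {x z : 𝒢.UnitPt} → 𝒢.Word x z → Prop
  | _, _, .nil _ => True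
  | _, _, .cons e g _ w =>
      g ∈ (T e).carrier _ _ ∧ w.FirstAfter e ∧ w.IsReduced T

end GraphOfGroupoids

/-!
The proof lets `ℱ(𝒢(Γ))` act on reduced words by left multiplication (van der Waerden's method).

An element `a` of a vertex groupoid multiplies a word `g₁ e₁ g₂ ⋯` as follows: decompose
`a g₁ = τ k` with `τ` in the transversal of `ℋ_{e₁}` and `k ∈ ℋ_{e₁}`, keep `τ e₁`, and let
`φ_{e₁}⁻¹(k)` multiply the remaining word (`Word.act`). As the decompositions are unique, this is
an action of the vertex groupoids (`Word.act_comp`, `Word.act_id`), and it preserves reducedness,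
since multiplication by an element of `ℋ_ē` does not change whether the first letter before an
edge `ē` lies in `ℋ_ē`. The generator of an edge `e` multiplies a reduced word by removing an
initial `1 ē` if there is one, and by prefixing `1 e` otherwise (`Word.edgeAct`). The edges `e` and
`ē` act by mutually inverse maps (`Word.edgeAct_edgeAct`), and the defining relation of an edge
holds for these operations (`Word.edgeAct_act_edgeAct`), so they define an action of `ℱ(𝒢(Γ))`
(`Word.homAct`).

The operations on words are compatible with the passage to `ℱ(𝒢(Γ))` (`Word.toHom_act`,
`Word.toHom_edgeAct`), so the set of morphisms that are represented by reduced words contains the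
units and is stable under left multiplication by generators. This gives existence. For uniqueness,
the morphism represented by a reduced word `w` sends the unit word to `w`
(`Word.mulReduced_toHom`), and so it determines `w`.
-/

/-! ### Free groupoids and inverses -/

/-- Every property of the morphisms of a free groupoid that holds for identities and is stable under
right multiplication by the generators and their inverses holds for all morphisms. -/
theorem Quiver.FreeGroupoid.hom_induction {Q : Type*} [Quiver Q] {x : Q}
    {motive : ∀ {y : Q},
      ((Quiver.FreeGroupoid.of Q).obj x ⟶ (Quiver.FreeGroupoid.of Q).obj y) → Prop}
    (id : motive (𝟙 _))
    (comp_of : ∀ {y z : Q} (m : (Quiver.FreeGroupoid.of Q).obj x ⟶ (Quiver.FreeGroupoid.of Q).obj y)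
      (g : y ⟶ z), motive m → motive (m ≫ (Quiver.FreeGroupoid.of Q).map g))
    (comp_inv : ∀ {y z : Q}
      (m : (Quiver.FreeGroupoid.of Q).obj x ⟶ (Quiver.FreeGroupoid.of Q).obj y)
      (g : z ⟶ y), motive m → motive (m ≫ Groupoid.inv ((Quiver.FreeGroupoid.of Q).map g)))
    {y : Q} (m : (Quiver.FreeGroupoid.of Q).obj x ⟶ (Quiver.FreeGroupoid.of Q).obj y) :
    motive m := by
  obtain ⟨p, rfl⟩ := (Quotient.functor Quiver.FreeGroupoid.redStep).map_surjective m
  change Quiver.Path (V := Quiver.Symmetrify Q) x y at p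
  induction p with
  | nil => exact id
  | @cons b c p s ih =>
    change @Quiver.Hom Q _ b c ⊕ @Quiver.Hom Q _ c b at s
    obtain g | g := s
    · exact comp_of _ g ih
    · exact comp_inv _ g ih

theorem CategoryTheory.Functor.map_groupoidInv_eq {C D : Type*} [Groupoid C] [Category D]
    (F : C ⥤ D) {x y : C} (g : x ⟶ y) {b : F.obj y ⟶ F.obj x} (h : F.map g ≫ b = 𝟙 _) :
    F.map (Groupoid.inv g) = b := by
  rw [← Category.comp_id (F.map _), ← h, ← Category.assoc, ← F.map_comp, Groupoid.inv_comp,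
    F.map_id, Category.id_comp]

namespace GraphOfGroupoids

variable {V : Type uV} {E : Type uE} {Γ : SerreGraph V E}
  {𝒢 : GraphOfGroupoids.{uV, uE, v₁, u₁, v₂, u₂} Γ}

/-! ### Elements of the vertex groupoids -/

variable (𝒢) in
/-- The arrows of the disjoint union of the vertex groupoids. Its objects are the units `UnitPt`,
so that source and range may be arbitrary variables, with no reference to a common vertex. -/
inductive Arr : 𝒢.UnitPt → 𝒢.UnitPt → Type (max uV v₁ u₁)
  | mk {v : V} {x y : 𝒢.vert v} (g : x ⟶ y) : Arr ⟨v, x⟩ ⟨v, y⟩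

namespace Arr

/-- The product of two composable elements. -/
def comp : {x y z : 𝒢.UnitPt} → 𝒢.Arr x y → 𝒢.Arr y z → 𝒢.Arr x z
  | _, _, _, mk g, mk h => mk (g ≫ h)

/-- The identity element at a unit. -/
def id (x : 𝒢.UnitPt) : 𝒢.Arr x x := mk (𝟙 x.pt)

/-- The inverse of an element. -/
def inv : {x y : 𝒢.UnitPt} → 𝒢.Arr x y → 𝒢.Arr y x
  | _, _, mk g => mk (Groupoid.inv g)

variable {x y z t : 𝒢.UnitPt}

@[simp]
theorem mk_comp_mk {v : V} {x y z : 𝒢.vert v} (g : x ⟶ y) (h : y ⟶ z) :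
    (mk g : 𝒢.Arr _ _).comp (mk h) = mk (g ≫ h) := rfl

theorem comp_assoc (a : 𝒢.Arr x y) (b : 𝒢.Arr y z) (c : 𝒢.Arr z t) :
    (a.comp b).comp c = a.comp (b.comp c) := by
  cases a; cases b; cases c; simp

@[simp]
theorem id_comp (a : 𝒢.Arr x y) : (id x).comp a = a := by
  cases a; simp [id]

@[simp]
theorem comp_id (a : 𝒢.Arr x y) : a.comp (id y) = a := by
  cases a; simp [id]

@[simp]
theorem inv_comp (a : 𝒢.Arr x y) : a.inv.comp a = id y := by
  cases a; simp [id, inv]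

@[simp]
theorem comp_inv (a : 𝒢.Arr x y) : a.comp a.inv = id x := by
  cases a; simp [id, inv]

theorem comp_left_cancel (a : 𝒢.Arr x y) {b c : 𝒢.Arr y z} (h : a.comp b = a.comp c) : b = c := by
  rw [← id_comp b, ← id_comp c, ← inv_comp a, comp_assoc, comp_assoc, h]

theorem mk_injective {v : V} {x y : 𝒢.vert v} :
    Function.Injective (mk : (x ⟶ y) → 𝒢.Arr ⟨v, x⟩ ⟨v, y⟩) := by
  intro g h e
  cases e
  rfl

end Arr

/-! ### The isomorphisms between the edge subgroupoids -/

/-- `φₑ` is injective on units. -/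
theorem PhiRel.source_unique {e : E} {y x x' : 𝒢.UnitPt} (h : 𝒢.PhiRel e y x)
    (h' : 𝒢.PhiRel e y x') : x = x' := by
  obtain ⟨z, rfl, rfl⟩ := h
  obtain ⟨z', hz, rfl⟩ := h'
  have hz' : z = z' := 𝒢.α_inj e (by simpa using hz)
  rw [hz']

variable (𝒢) in
/-- The isomorphism `φₑ⁻¹ : ℋₑ → ℋ_ē` as a relation: `𝒢.Corr e a b` says that `a = αₑ(g)` and
`b = α_ē(g)` for an element `g` of the edge groupoid. -/
inductive Corr (e : E) : ∀ {x y x' y' : 𝒢.UnitPt}, 𝒢.Arr x y → 𝒢.Arr x' y' → Prop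
  | map {p q : 𝒢.edge e} (g : p ⟶ q) :
      Corr e (Arr.mk ((𝒢.α e).map g)) (Arr.mk ((𝒢.αbar e).map g))

variable (𝒢) in
/-- `𝒢.InH e a` says that `a` lies in the subgroupoid `ℋₑ`. -/
def InH (e : E) {x y : 𝒢.UnitPt} (a : 𝒢.Arr x y) : Prop :=
  ∃ (x' y' : 𝒢.UnitPt) (b : 𝒢.Arr x' y'), 𝒢.Corr e a b

namespace Corr

variable {e : E} {x y z x' y' z' : 𝒢.UnitPt}

theorem exists_eq {a : 𝒢.Arr x y} {b : 𝒢.Arr x' y'} (h : 𝒢.Corr e a b) :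
    ∃ (p q : 𝒢.edge e) (g : p ⟶ q), x = ⟨Γ.t e, (𝒢.α e).obj p⟩ ∧ y = ⟨Γ.t e, (𝒢.α e).obj q⟩ ∧
      x' = ⟨Γ.o e, (𝒢.αbar e).obj p⟩ ∧ y' = ⟨Γ.o e, (𝒢.αbar e).obj q⟩ ∧
      HEq a (Arr.mk ((𝒢.α e).map g) : 𝒢.Arr _ _) ∧
      HEq b (Arr.mk ((𝒢.αbar e).map g) : 𝒢.Arr _ _) := by
  cases h with
  | map g => exact ⟨_, _, g, rfl, rfl, rfl, rfl, HEq.rfl, HEq.rfl⟩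

theorem inH {a : 𝒢.Arr x y} {b : 𝒢.Arr x' y'} (h : 𝒢.Corr e a b) : 𝒢.InH e a := ⟨_, _, _, h⟩

theorem phiRel_range {a : 𝒢.Arr x y} {b : 𝒢.Arr x' y'} (h : 𝒢.Corr e a b) : 𝒢.PhiRel e x x' := by
  cases h
  exact 𝒢.phiRel_α e _

theorem phiRel_source {a : 𝒢.Arr x y} {b : 𝒢.Arr x' y'} (h : 𝒢.Corr e a b) :
    𝒢.PhiRel e y y' := by
  cases h
  exact 𝒢.phiRel_α e _

theorem mk_α_map_grpdCast {e f : E} (h : f = e) {C : Grpd.{v₂, u₂}} (hC : 𝒢.edge e = C)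
    (hf : C = 𝒢.edge f) {p q : 𝒢.edge e} (g : p ⟶ q) :
    HEq (Arr.mk ((𝒢.α f).map ((grpdCast hf).map ((grpdCast hC).map g))) : 𝒢.Arr _ _)
      (Arr.mk ((𝒢.α e).map g) : 𝒢.Arr _ _) := by
  subst h
  subst hC
  rfl

theorem symm {a : 𝒢.Arr x y} {b : 𝒢.Arr x' y'} (h : 𝒢.Corr e a b) : 𝒢.Corr (Γ.rev e) b a := by
  cases h with
  | @map p q g =>
    have key := Corr.map (𝒢 := 𝒢) (e := Γ.rev e) ((grpdCast (𝒢.edge_rev e).symm).map g)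
    -- The composite of the two casts `𝒢ₑ = 𝒢_ē = 𝒢_{ē̄}` is the cast along `ē̄ = e`.
    have hobj : ∀ r : 𝒢.edge e,
        (⟨Γ.o (Γ.rev e), (𝒢.αbar (Γ.rev e)).obj ((grpdCast (𝒢.edge_rev e).symm).obj r)⟩ :
          𝒢.UnitPt) = ⟨Γ.t e, (𝒢.α e).obj r⟩ := fun r => by
      simp only [αbar, Functor.comp_obj, grpdCast_obj_trans]
      exact (𝒢.unitPt_cast (Γ.rev_rev e) _ r).symm
    have harr : HEq (Arr.mk ((𝒢.αbar (Γ.rev e)).map ((grpdCast (𝒢.edge_rev e).symm).map g)) :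
        𝒢.Arr _ _) (Arr.mk ((𝒢.α e).map g) : 𝒢.Arr _ _) :=
      mk_α_map_grpdCast (Γ.rev_rev e) _ _ g
    have hp := hobj p
    have hq := hobj q
    revert key harr
    generalize (Arr.mk ((𝒢.αbar (Γ.rev e)).map ((grpdCast (𝒢.edge_rev e).symm).map g)) :
      𝒢.Arr _ _) = c
    revert c
    rw [hp, hq]
    rintro c key rfl
    exact key

theorem comp {a : 𝒢.Arr x y} {b : 𝒢.Arr x' y'} {c : 𝒢.Arr y z} {d : 𝒢.Arr y' z'}
    (h : 𝒢.Corr e a b) (k : 𝒢.Corr e c d) : 𝒢.Corr e (a.comp c) (b.comp d) := by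
  obtain ⟨p, q, g, rfl, rfl, rfl, rfl, ⟨⟩, ⟨⟩⟩ := h.exists_eq
  obtain ⟨q', r, g', hq, rfl, _, rfl, hc, hd⟩ := k.exists_eq
  obtain rfl : q = q' := 𝒢.α_inj e (by simpa using hq)
  cases hc
  cases hd
  simpa using Corr.map (𝒢 := 𝒢) (g ≫ g')

theorem inv {a : 𝒢.Arr x y} {b : 𝒢.Arr x' y'} (h : 𝒢.Corr e a b) : 𝒢.Corr e a.inv b.inv := by
  cases h with
  | map g => simpa [Arr.inv] using Corr.map (𝒢 := 𝒢) (Groupoid.inv g)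

theorem id (h : 𝒢.PhiRel e x x') : 𝒢.Corr e (Arr.id x) (Arr.id x') := by
  obtain ⟨z, rfl, rfl⟩ := h
  simpa [Arr.id] using Corr.map (𝒢 := 𝒢) (𝟙 z)

theorem right_unique {a : 𝒢.Arr x y} {b b' : 𝒢.Arr x' y'}
    (h : 𝒢.Corr e a b) (k : 𝒢.Corr e a b') : b = b' := by
  obtain ⟨p, q, g, rfl, rfl, rfl, rfl, ⟨⟩, ⟨⟩⟩ := h.exists_eq
  obtain ⟨p', q', g', hp, hq, -, -, ha, hb⟩ := k.exists_eq
  obtain rfl : p = p' := 𝒢.α_inj e (by simpa using hp)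
  obtain rfl : q = q' := 𝒢.α_inj e (by simpa using hq)
  have := 𝒢.α_faithful e
  obtain rfl : g = g' := (𝒢.α e).map_injective (Arr.mk_injective (eq_of_heq ha))
  exact (eq_of_heq hb).symm

end Corr

namespace InH

variable {e : E} {x y z : 𝒢.UnitPt}

theorem inv {a : 𝒢.Arr x y} (h : 𝒢.InH e a) : 𝒢.InH e a.inv := by
  obtain ⟨_, _, _, h⟩ := h
  exact h.inv.inH

theorem comp {a : 𝒢.Arr x y} {b : 𝒢.Arr y z} (h : 𝒢.InH e a) (k : 𝒢.InH e b) :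
    𝒢.InH e (a.comp b) := by
  obtain ⟨_, y₁, _, h⟩ := h
  obtain ⟨y₂, _, _, k⟩ := k
  obtain rfl := h.phiRel_source.source_unique k.phiRel_range
  exact (h.comp k).inH

theorem of_comp_left {a : 𝒢.Arr x y} {b : 𝒢.Arr y z} (h : 𝒢.InH e (a.comp b))
    (k : 𝒢.InH e a) : 𝒢.InH e b := by
  simpa [← Arr.comp_assoc] using k.inv.comp h

end InH

theorem inH_mk_iff {e : E} {x y : 𝒢.vert (Γ.t e)} (g : x ⟶ y) :
    𝒢.InH e (Arr.mk g) ↔ g ∈ (𝒢.H e).arrows x y := by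
  constructor
  · rintro ⟨x', y', b, h⟩
    obtain ⟨p, q, k, hx, hy, rfl, rfl, ha, -⟩ := h.exists_eq
    obtain rfl : x = (𝒢.α e).obj p := by simpa using hx
    obtain rfl : y = (𝒢.α e).obj q := by simpa using hy
    rw [Arr.mk_injective (eq_of_heq ha)]
    exact Subgroupoid.Map.Arrows.im k trivial
  · intro h
    cases h with
    | im k _ => exact (Corr.map k).inH

/-! ### Decompositions along a transversal -/

/-- Membership in the transversal of `ℋₑ`, for elements of the disjoint union of the vertex
groupoids. -/
inductive LeftTransversal.Mem {e : E} (T : 𝒢.LeftTransversal e) :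
    ∀ {x y : 𝒢.UnitPt}, 𝒢.Arr x y → Prop
  | mk {x y : 𝒢.vert (Γ.t e)} {g : x ⟶ y} (h : g ∈ T.carrier x y) : T.Mem (Arr.mk g)

theorem LeftTransversal.mem_mk_iff {e : E} (T : 𝒢.LeftTransversal e) {x y : 𝒢.vert (Γ.t e)}
    (g : x ⟶ y) : T.Mem (Arr.mk g) ↔ g ∈ T.carrier x y := by
  constructor
  · intro h
    cases h with
    | mk h => exact h
  · exact Mem.mk

theorem LeftTransversal.mem_id {e : E} (T : 𝒢.LeftTransversal e) {x x' : 𝒢.UnitPt}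
    (h : 𝒢.PhiRel e x x') : T.Mem (Arr.id x) := by
  obtain ⟨z, rfl, rfl⟩ := h
  exact .mk (T.id_mem _)

/-- A decomposition `a = τ k` with `τ` in the transversal of `ℋₑ` and `k ∈ ℋₑ`, along with the
element `k' = φₑ⁻¹(k)`. The unit `y'` is `φₑ⁻¹` of the source of `a`. -/
structure Decomp {e : E} (T : 𝒢.LeftTransversal e) {x y : 𝒢.UnitPt} (a : 𝒢.Arr x y)
    (y' : 𝒢.UnitPt) where
  mid : 𝒢.UnitPt
  mid' : 𝒢.UnitPt
  τ : 𝒢.Arr x mid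
  k : 𝒢.Arr mid y
  k' : 𝒢.Arr mid' y'
  mem : T.Mem τ
  corr : 𝒢.Corr e k k'
  eq : a = τ.comp k

namespace Decomp

variable {e : E} {T : 𝒢.LeftTransversal e} {x y y' : 𝒢.UnitPt} {a : 𝒢.Arr x y}

theorem nonempty (T : 𝒢.LeftTransversal e) (a : 𝒢.Arr x y) (h : 𝒢.PhiRel e y y') :
    Nonempty (Decomp T a y') := by
  obtain ⟨z, rfl, rfl⟩ := h
  cases a with
  | mk g =>
    obtain ⟨⟨m, τ⟩, ⟨hτ, k, hk, rfl⟩, -⟩ := T.existsUnique_coset g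
    obtain ⟨m', y', k', h⟩ := (inH_mk_iff k).2 hk
    obtain rfl := h.phiRel_source.source_unique (𝒢.phiRel_α e z)
    exact ⟨⟨_, _, _, _, k', .mk hτ, h, rfl⟩⟩

/-- Decompositions are unique: `τ` is the representative of the coset `a ℋₑ`, which determines `k`,
and `k` determines `k'`. -/
theorem subsingleton (d d' : Decomp T a y') : d = d' := by
  obtain ⟨m, m', τ, k, k', hτ, hk, rfl⟩ := d
  obtain ⟨n, n', σ, l, l', hσ, hl, h⟩ := d'
  cases hτ with
  | @mk x m τ hτ =>
  cases k with
  | @mk _ _ y k =>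
  obtain ⟨s, hs⟩ : ∃ s, n = ⟨Γ.t e, s⟩ := by
    obtain ⟨z, hz, -⟩ := hl.phiRel_range
    exact ⟨_, hz⟩
  subst hs
  cases σ with
  | mk σ =>
  cases l with
  | mk l =>
  rw [T.mem_mk_iff] at hσ
  have hu := (T.existsUnique_coset (τ ≫ k)).unique (y₁ := ⟨m, τ⟩) (y₂ := ⟨s, σ⟩)
    ⟨hτ, k, (inH_mk_iff k).1 hk.inH, rfl⟩
    ⟨hσ, l, (inH_mk_iff l).1 hl.inH, Arr.mk_injective (by simpa using h)⟩
  cases hu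
  obtain rfl := hk.phiRel_range.source_unique hl.phiRel_range
  have hkl := Arr.comp_left_cancel _ h
  rw [← hkl] at hl
  cases hkl
  obtain rfl := hk.right_unique hl
  rfl

end Decomp

/-- An element of the transversal that lies in `ℋₑ` is a unit. -/
theorem LeftTransversal.Mem.eq_id {e : E} {T : 𝒢.LeftTransversal e} {x y : 𝒢.UnitPt}
    {a : 𝒢.Arr x y} (ha : T.Mem a) (h : 𝒢.InH e a) : ∃ hxy : x = y, hxy ▸ a = Arr.id x := by
  obtain ⟨x', y', b, h⟩ := h
  -- Both `a = a · 1` and `a = 1 · a` are decompositions of `a`.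
  have key := Decomp.subsingleton (T := T) (a := a) (y' := y')
    ⟨x, x', Arr.id x, a, b, T.mem_id h.phiRel_range, h, by simp⟩
    ⟨y, y', a, Arr.id y, Arr.id y', ha, .id h.phiRel_source, by simp⟩
  obtain rfl : x = y := congrArg Decomp.mid key
  refine ⟨rfl, ?_⟩
  cases a
  simp only [Decomp.mk.injEq] at key
  exact (eq_of_heq key.2.2.1).symm

namespace Word

/-! ### Words over the disjoint union of the vertex groupoids -/

/-- The word of length `0` given by an element. -/
def ofArr : {x z : 𝒢.UnitPt} → 𝒢.Arr x z → 𝒢.Word x z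
  | _, _, .mk g => .nil g

/-- The word `a e w`. In contrast to `Word.cons`, the type of `a` does not refer to `t(e)`. -/
def consArr (e : E) : {x y y' z : 𝒢.UnitPt} → 𝒢.Arr x y → 𝒢.PhiRel e y y' → 𝒢.Word y' z →
    𝒢.Word x z
  | _, _, _, _, .mk (v := v) g, h, w =>
    have hv : v = Γ.t e := by
      obtain ⟨_, hz, -⟩ := h
      exact congrArg UnitPt.vertex hz
    by
      subst hv
      exact .cons e g h w

variable {x y z x' y' z' : 𝒢.UnitPt} {e f : E} {T : ∀ e, 𝒢.LeftTransversal e}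

@[simp]
theorem consArr_mk {x y : 𝒢.vert (Γ.t e)} (g : x ⟶ y) (h : 𝒢.PhiRel e ⟨Γ.t e, y⟩ y')
    (w : 𝒢.Word y' z) : consArr e (.mk g) h w = .cons e g h w := rfl

/-- Induction on words, with all units and elements in the disjoint union of the vertex
groupoids. -/
@[elab_as_elim]
theorem arr_induction {motive : ∀ {x z : 𝒢.UnitPt}, 𝒢.Word x z → Prop}
    (ofArr : ∀ {x z} (a : 𝒢.Arr x z), motive (ofArr a))
    (consArr : ∀ (e : E) {x y y' z} (a : 𝒢.Arr x y) (h : 𝒢.PhiRel e y y') (w : 𝒢.Word y' z),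
      motive w → motive (consArr e a h w)) {x z : 𝒢.UnitPt} (w : 𝒢.Word x z) : motive w := by
  induction w with
  | nil g => exact ofArr (.mk g)
  | cons e g h w ih => exact consArr e (.mk g) h w ih

/-- The case analysis on `a e w`: the range of `a e` may be taken to be in `𝒢_{t(e)}`. -/
theorem exists_eq_mk {a : 𝒢.Arr x y} (h : 𝒢.PhiRel e y y') :
    ∃ (p q : 𝒢.vert (Γ.t e)) (g : p ⟶ q), x = ⟨_, p⟩ ∧ y = ⟨_, q⟩ ∧
      HEq a (Arr.mk g : 𝒢.Arr _ _) := by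
  cases a with
  | @mk v _ _ g =>
    obtain ⟨_, hz, -⟩ := h
    obtain rfl : v = Γ.t e := congrArg UnitPt.vertex hz
    exact ⟨_, _, g, rfl, rfl, HEq.rfl⟩

@[simp]
theorem firstAfter_ofArr (a : 𝒢.Arr x z) : (ofArr a).FirstAfter e := by
  cases a
  trivial

theorem firstAfter_consArr {a : 𝒢.Arr x y} {h : 𝒢.PhiRel f y y'} {w : 𝒢.Word y' z} :
    (consArr f a h w).FirstAfter e ↔ (Γ.rev f = e → ¬ 𝒢.InH f a) := by
  obtain ⟨p, q, g, rfl, rfl, ⟨⟩⟩ := exists_eq_mk (a := a) h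
  rw [inH_mk_iff]
  rfl

@[simp]
theorem isReduced_ofArr (a : 𝒢.Arr x z) : (ofArr a).IsReduced T := by
  cases a
  trivial

theorem isReduced_consArr {a : 𝒢.Arr x y} {h : 𝒢.PhiRel e y y'} {w : 𝒢.Word y' z} :
    (consArr e a h w).IsReduced T ↔ (T e).Mem a ∧ w.FirstAfter e ∧ w.IsReduced T := by
  obtain ⟨p, q, g, rfl, rfl, ⟨⟩⟩ := exists_eq_mk (a := a) h
  rw [LeftTransversal.mem_mk_iff]
  rfl

/-! ### Left multiplication of words by elements of the vertex groupoids -/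

variable (T) in
/-- The product `a · w` of an element `a` and a word `w = g₁ e₁ g₂ ⋯`. It is computed by writing
`a g₁ = τ k` with `τ` in the transversal and `k ∈ ℋ_{e₁}`, and moving `k` past the edge `e₁`. -/
noncomputable def act {x y z : 𝒢.UnitPt} (a : 𝒢.Arr x y) (w : 𝒢.Word y z) : 𝒢.Word x z :=
  match w, a with
  | .nil g, a => ofArr (a.comp (.mk g))
  | .cons e g h w, a =>
    let d := Classical.choice (Decomp.nonempty (T e) (a.comp (.mk g)) h)
    consArr e d.τ d.corr.phiRel_range (act d.k' w)

@[simp]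
theorem act_ofArr (a : 𝒢.Arr x y) (b : 𝒢.Arr y z) : act T a (ofArr b) = ofArr (a.comp b) := by
  cases b
  simp [ofArr, act]

theorem act_consArr (a : 𝒢.Arr x y) {y₁ : 𝒢.UnitPt} (b : 𝒢.Arr y y₁) (h : 𝒢.PhiRel e y₁ y')
    (w : 𝒢.Word y' z) (d : Decomp (T e) (a.comp b) y') :
    act T a (consArr e b h w) = consArr e d.τ d.corr.phiRel_range (act T d.k' w) := by
  obtain ⟨p, q, g, rfl, rfl, ⟨⟩⟩ := exists_eq_mk (a := b) h
  rw [consArr_mk, act,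
    Decomp.subsingleton d (Classical.choice (Decomp.nonempty (T e) (a.comp (.mk g)) h))]

/-- Reducedness is needed: multiplication by a unit replaces the letters of a word by the
representatives of their cosets. -/
theorem act_id {w : 𝒢.Word x z} (hw : w.IsReduced T) : act T (.id x) w = w := by
  induction w using arr_induction with
  | ofArr a => simp
  | consArr e a h w ih =>
    rw [isReduced_consArr] at hw
    rw [act_consArr _ _ _ _ ⟨_, _, a, .id _, .id _, hw.1, .id h, by simp⟩, ih hw.2.2]

theorem act_comp (a : 𝒢.Arr x y) {y₁ : 𝒢.UnitPt} (b : 𝒢.Arr y y₁) (w : 𝒢.Word y₁ z) :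
    act T (a.comp b) w = act T a (act T b w) := by
  induction w using arr_induction generalizing x y with
  | ofArr c => simp [Arr.comp_assoc]
  | consArr e c h w ih =>
    obtain ⟨d⟩ := Decomp.nonempty (T e) (b.comp c) h
    obtain ⟨d'⟩ := Decomp.nonempty (T e) (a.comp d.τ) d.corr.phiRel_range
    rw [act_consArr b c h w d, act_consArr a _ _ _ d', ← ih]
    exact act_consArr _ _ _ _ ⟨_, _, d'.τ, d'.k.comp d.k, d'.k'.comp d.k', d'.mem,
      d'.corr.comp d.corr, by
        rw [Arr.comp_assoc, ← Arr.comp_assoc d'.τ, ← d'.eq, Arr.comp_assoc, ← d.eq]⟩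

/-- Multiplication by an element of `ℋ_ē` does not create a cancellation with the edge `e`: if
`b ∈ ℋ_ē` and `b c = τ l` with `l ∈ ℋ_ē`, then `τ ∈ ℋ_ē` only if `c ∈ ℋ_ē`. -/
theorem FirstAfter.act {a : 𝒢.Arr x y} {b : 𝒢.Arr x' y'} (hab : 𝒢.Corr e a b)
    {w : 𝒢.Word y' z} (hw : w.FirstAfter e) : (act T b w).FirstAfter e := by
  induction w using arr_induction with
  | ofArr c => simp
  | consArr f c h w _ =>
    obtain ⟨d⟩ := Decomp.nonempty (T f) (b.comp c) h
    rw [act_consArr _ _ _ _ d]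
    rw [firstAfter_consArr] at hw ⊢
    rintro rfl hτ
    have hbc := hτ.comp d.corr.inH
    rw [← d.eq] at hbc
    refine hw rfl (hbc.of_comp_left ?_)
    simpa only [Γ.rev_rev] using hab.symm.inH

theorem IsReduced.act (a : 𝒢.Arr x y) {w : 𝒢.Word y z} (hw : w.IsReduced T) :
    (act T a w).IsReduced T := by
  induction w using arr_induction generalizing x with
  | ofArr c => simp
  | consArr e c h w ih =>
    obtain ⟨d⟩ := Decomp.nonempty (T e) (a.comp c) h
    rw [isReduced_consArr] at hw
    rw [act_consArr _ _ _ _ d, isReduced_consArr]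
    exact ⟨d.mem, hw.2.1.act d.corr, ih _ hw.2.2⟩

/-! ### Left multiplication of words by edges -/

variable (T) in
open Classical in
/-- The product of the generator `(φₑ(x), x)` and a word `w`: if `w = h ē w'` with `h ∈ ℋ_ē`, this
is `φₑ(h) · w'`, and otherwise it is the word `1 e w`. In a reduced word such an `h` is a unit;
allowing all of `ℋ_ē` spares the identification of the range and the source of `h`. -/
noncomputable def edgeAct (e : E) {x y z : 𝒢.UnitPt} (p : 𝒢.PhiRel e y x) (w : 𝒢.Word x z) :
    𝒢.Word y z :=
  match w, p with
  | .nil g, p => consArr e (.id y) p (.nil g)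
  | .cons (y' := y') f g q w, p =>
    if h : Γ.rev f = e ∧ ∃ b : 𝒢.Arr y y', 𝒢.Corr f (.mk g) b then act T h.2.choose w
    else consArr e (.id y) p (.cons f g q w)

theorem edgeAct_of_firstAfter (p : 𝒢.PhiRel e y x) {w : 𝒢.Word x z} (hw : w.FirstAfter e) :
    edgeAct T e p w = consArr e (.id y) p w := by
  cases w with
  | nil g => rfl
  | cons f g q w =>
    rw [edgeAct, dif_neg]
    rintro ⟨h, b, hb⟩
    exact hw h ((inH_mk_iff g).1 hb.inH)

theorem edgeAct_consArr_id (hf : Γ.rev f = e) (p : 𝒢.PhiRel e y x) (q : 𝒢.PhiRel f x y)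
    {w : 𝒢.Word y z} (hw : w.IsReduced T) : edgeAct T e p (consArr f (.id x) q w) = w := by
  obtain ⟨r, rfl, rfl⟩ := id q
  have h : Γ.rev f = e ∧ ∃ b : 𝒢.Arr _ _, 𝒢.Corr f (.mk (𝟙 ((𝒢.α f).obj r))) b :=
    ⟨hf, _, Corr.id q⟩
  rw [Arr.id, consArr_mk, edgeAct, dif_pos h, h.2.choose_spec.right_unique (Corr.id q), act_id hw]

/-- A reduced word either does not cancel against the edge `e`, or it is the product of `ē` and a
reduced word which does not cancel against `ē`. -/
theorem IsReduced.firstAfter_or_exists (hf : Γ.rev f = e) (q : 𝒢.PhiRel f x y) {w : 𝒢.Word x z}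
    (hw : w.IsReduced T) : w.FirstAfter e ∨
      ∃ w' : 𝒢.Word y z, w'.IsReduced T ∧ w'.FirstAfter f ∧ w = consArr f (.id x) q w' := by
  induction w using arr_induction with
  | ofArr a => simp
  | consArr f' a h w _ =>
    rw [isReduced_consArr] at hw
    rw [firstAfter_consArr, or_iff_not_imp_left, Classical.not_imp, not_not]
    rintro ⟨hf', ha⟩
    obtain rfl : f = f' := by rw [← Γ.rev_rev f, hf, ← hf', Γ.rev_rev]
    obtain ⟨rfl, rfl⟩ := hw.1.eq_id ha
    obtain rfl := q.source_unique h
    exact ⟨w, hw.2.2, hw.2.1, rfl⟩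

theorem IsReduced.edgeAct (p : 𝒢.PhiRel e y x) {w : 𝒢.Word x z} (hw : w.IsReduced T) :
    (edgeAct T e p w).IsReduced T := by
  obtain h | ⟨w', hw', -, rfl⟩ := hw.firstAfter_or_exists (Γ.rev_rev e) (PhiRel.symm 𝒢 p)
  · rw [edgeAct_of_firstAfter p h, isReduced_consArr]
    exact ⟨(T e).mem_id p, h, hw⟩
  · rwa [edgeAct_consArr_id (Γ.rev_rev e) p _ hw']

theorem edgeAct_edgeAct (hf : Γ.rev f = e) (p : 𝒢.PhiRel e y x) (q : 𝒢.PhiRel f x y)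
    {w : 𝒢.Word x z} (hw : w.IsReduced T) : edgeAct T f q (edgeAct T e p w) = w := by
  obtain h | ⟨w', hw', h', rfl⟩ := hw.firstAfter_or_exists hf q
  · rw [edgeAct_of_firstAfter p h, edgeAct_consArr_id (by rw [← hf, Γ.rev_rev]) q p hw]
  · rw [edgeAct_consArr_id hf p q hw', edgeAct_of_firstAfter q h']

/-- Multiplication by an edge intertwines the multiplications by corresponding elements of the
subgroupoids `ℋₑ` and `ℋ_ē`. -/
theorem act_edgeAct {a : 𝒢.Arr x y} {b : 𝒢.Arr x' y'} (hab : 𝒢.Corr e a b) {w : 𝒢.Word y' z}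
    (hw : w.IsReduced T) :
    act T a (edgeAct T e hab.phiRel_source w) = edgeAct T e hab.phiRel_range (act T b w) := by
  -- The case without cancellation, for an arbitrary edge.
  have main : ∀ {e : E} {x y x' y' : 𝒢.UnitPt} {a : 𝒢.Arr x y} {b : 𝒢.Arr x' y'}
      (hab : 𝒢.Corr e a b) {w : 𝒢.Word y' z}, w.FirstAfter e →
      act T a (edgeAct T e hab.phiRel_source w) = edgeAct T e hab.phiRel_range (act T b w) := by
    intro e x y x' y' a b hab w h
    rw [edgeAct_of_firstAfter _ h, edgeAct_of_firstAfter _ (h.act hab)]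
    exact act_consArr _ _ _ _ ⟨_, _, .id x, a, b, (T e).mem_id hab.phiRel_range, hab, by simp⟩
  obtain h | ⟨w', hw', h', rfl⟩ :=
    hw.firstAfter_or_exists (Γ.rev_rev e) hab.symm.phiRel_source
  · exact main hab h
  · -- With cancellation, `w = ē w'`, and the case of `ē` and `w'` applies.
    rw [← edgeAct_of_firstAfter hab.symm.phiRel_source h', main hab.symm h',
      edgeAct_edgeAct rfl _ _ hw', edgeAct_edgeAct rfl _ _ (hw'.act a)]

/-- The relation `e · α_ē(g) · ē = αₑ(g)` holds for the multiplications of reduced words. -/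
theorem edgeAct_act_edgeAct {a : 𝒢.Arr x y} {b : 𝒢.Arr x' y'} (hab : 𝒢.Corr e a b)
    {w : 𝒢.Word y z} (hw : w.IsReduced T) :
    edgeAct T e hab.phiRel_range (act T b (edgeAct T (Γ.rev e) hab.symm.phiRel_source w)) =
      act T a w := by
  rw [← act_edgeAct hab (hw.edgeAct _), edgeAct_edgeAct rfl _ _ hw]

end Word

/-! ### Relations in the presented groupoid -/

/-- The class in `ℱ(𝒢(Γ))` of an element of the disjoint union of the vertex groupoids. -/
def homOfArr : {x y : 𝒢.UnitPt} → 𝒢.Arr x y → (𝒢.unit x ⟶ 𝒢.unit y)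
  | _, _, .mk g => 𝒢.ofVert g

variable {x y z x' y' : 𝒢.UnitPt} {e f : E}

theorem homOfArr_id (x : 𝒢.UnitPt) : homOfArr (Arr.id x) = 𝟙 (𝒢.unit x) :=
  CategoryTheory.Quotient.sound _ (Rel.vert_id x.pt)

theorem homOfArr_comp (a : 𝒢.Arr x y) (b : 𝒢.Arr y z) :
    homOfArr (a.comp b) = homOfArr a ≫ homOfArr b := by
  cases a
  cases b
  exact (CategoryTheory.Quotient.sound _ (Rel.vert_comp _ _)).symm

theorem ofEdge_comp_homOfArr_comp_ofEdge {a : 𝒢.Arr x y} {b : 𝒢.Arr x' y'}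
    (h : 𝒢.Corr e a b) :
    𝒢.ofEdge e h.phiRel_range ≫ homOfArr b ≫ 𝒢.ofEdge (Γ.rev e) (PhiRel.symm 𝒢 h.phiRel_source) =
      homOfArr a := by
  cases h
  exact CategoryTheory.Quotient.sound _ (Rel.edge e _)

theorem ofEdge_comp_ofEdge (hf : Γ.rev e = f) (p : 𝒢.PhiRel e y x) (q : 𝒢.PhiRel f x y) :
    𝒢.ofEdge e p ≫ 𝒢.ofEdge f q = 𝟙 _ := by
  subst hf
  simpa [homOfArr_id] using ofEdge_comp_homOfArr_comp_ofEdge (Corr.id p)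

theorem homOfArr_comp_ofEdge {a : 𝒢.Arr x y} {b : 𝒢.Arr x' y'} (h : 𝒢.Corr e a b) :
    homOfArr a ≫ 𝒢.ofEdge e h.phiRel_source = 𝒢.ofEdge e h.phiRel_range ≫ homOfArr b := by
  rw [← ofEdge_comp_homOfArr_comp_ofEdge h, Category.assoc, Category.assoc,
    ofEdge_comp_ofEdge (Γ.rev_rev e), Category.comp_id]

/-- Every property of the morphisms of `ℱ(𝒢(Γ))` that holds for identities and is stable under
right multiplication by the generators holds for all morphisms. The inverses of the generators
are generators. -/
theorem hom_induction {x : 𝒢.UnitPt} {motive : ∀ {y : 𝒢.UnitPt}, (𝒢.unit x ⟶ 𝒢.unit y) → Prop}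
    (id : motive (𝟙 (𝒢.unit x)))
    (comp_arr : ∀ {y z} (m : 𝒢.unit x ⟶ 𝒢.unit y) (a : 𝒢.Arr y z), motive m →
      motive (m ≫ homOfArr a))
    (comp_edge : ∀ {y z} (m : 𝒢.unit x ⟶ 𝒢.unit y) (e : E) (h : 𝒢.PhiRel e y z), motive m →
      motive (m ≫ 𝒢.ofEdge e h))
    {y : 𝒢.UnitPt} (m : 𝒢.unit x ⟶ 𝒢.unit y) : motive m := by
  obtain ⟨m, rfl⟩ := (Quotient.functor 𝒢.Rel).map_surjective m
  refine Quiver.FreeGroupoid.hom_induction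
    (motive := fun {y} m => motive (y := y) ((Quotient.functor 𝒢.Rel).map m)) ?_ ?_ ?_ m
  · exact id
  · rintro _ _ m (g | ⟨e, h⟩) ih <;> rw [Functor.map_comp]
    · exact comp_arr _ (.mk g) ih
    · exact comp_edge _ e h ih
  · rintro _ _ m (g | ⟨e, h⟩) ih <;> rw [Functor.map_comp]
    · refine Eq.subst (motive := fun k => motive ((Quotient.functor 𝒢.Rel).map m ≫ k))
        (Functor.map_groupoidInv_eq _ _ ?_).symm (comp_arr _ (Arr.mk g).inv ih)
      refine (homOfArr_comp (.mk g) (Arr.mk g).inv).symm.trans ?_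
      rw [Arr.comp_inv, homOfArr_id]
      rfl
    · exact Eq.subst (motive := fun k => motive ((Quotient.functor 𝒢.Rel).map m ≫ k))
        (Functor.map_groupoidInv_eq _ _ (ofEdge_comp_ofEdge rfl h (PhiRel.symm 𝒢 h))).symm
        (comp_edge _ _ _ ih)

/-! ### Words and morphisms -/

namespace Word

variable {T : ∀ e, 𝒢.LeftTransversal e}

theorem toHom_ofArr (a : 𝒢.Arr x z) : (ofArr a).toHom = homOfArr a := by
  cases a
  rfl

theorem toHom_consArr (a : 𝒢.Arr x y) (h : 𝒢.PhiRel e y y') (w : 𝒢.Word y' z) :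
    (consArr e a h w).toHom = homOfArr a ≫ 𝒢.ofEdge e h ≫ w.toHom := by
  obtain ⟨p, q, g, rfl, rfl, ⟨⟩⟩ := exists_eq_mk (a := a) h
  rfl

theorem toHom_act (a : 𝒢.Arr x y) (w : 𝒢.Word y z) :
    (act T a w).toHom = homOfArr a ≫ w.toHom := by
  induction w using arr_induction generalizing x with
  | ofArr b => rw [act_ofArr, toHom_ofArr, toHom_ofArr, homOfArr_comp]
  | consArr e b h w ih =>
    obtain ⟨d⟩ := Decomp.nonempty (T e) (a.comp b) h
    rw [act_consArr _ _ _ _ d, toHom_consArr, toHom_consArr, ih,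
      ← Category.assoc (homOfArr a), ← homOfArr_comp, congrArg homOfArr d.eq, homOfArr_comp,
      Category.assoc, ← Category.assoc (homOfArr d.k), homOfArr_comp_ofEdge d.corr, Category.assoc]

theorem toHom_edgeAct (p : 𝒢.PhiRel e y x) {w : 𝒢.Word x z} (hw : w.IsReduced T) :
    (edgeAct T e p w).toHom = 𝒢.ofEdge e p ≫ w.toHom := by
  obtain h | ⟨w', hw', -, rfl⟩ := hw.firstAfter_or_exists (Γ.rev_rev e) (PhiRel.symm 𝒢 p)
  · rw [edgeAct_of_firstAfter p h, toHom_consArr, homOfArr_id, Category.id_comp]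
  · rw [edgeAct_consArr_id (Γ.rev_rev e) p _ hw', toHom_consArr, homOfArr_id, Category.id_comp,
      ← Category.assoc, ofEdge_comp_ofEdge rfl, Category.id_comp]

/-- Every morphism of `ℱ(𝒢(Γ))` is represented by a reduced word. -/
theorem exists_isReduced_toHom_eq (T : ∀ e, 𝒢.LeftTransversal e) (m : 𝒢.unit x ⟶ 𝒢.unit z) :
    ∃ w : 𝒢.Word x z, w.IsReduced T ∧ w.toHom = m := by
  -- The morphisms `m` such that left multiplication by `m` preserves the set of the morphisms
  -- represented by reduced words contain the generators and are stable under products.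
  suffices ∀ w : 𝒢.Word z z, w.IsReduced T → ∃ w' : 𝒢.Word x z, w'.IsReduced T ∧
      w'.toHom = m ≫ w.toHom by
    simpa [toHom_ofArr, homOfArr_id] using this (ofArr (.id z)) (isReduced_ofArr _)
  refine hom_induction (motive := fun {y} m => ∀ w : 𝒢.Word y z, w.IsReduced T →
    ∃ w' : 𝒢.Word x z, w'.IsReduced T ∧ w'.toHom = m ≫ w.toHom) ?_ ?_ ?_ m
  · exact fun w hw => ⟨w, hw, by simp⟩
  · intro y y' m a ih w hw
    simpa [toHom_act] using ih _ (hw.act a)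
  · intro y y' m e h ih w hw
    simpa [toHom_edgeAct h hw] using ih _ (hw.edgeAct h)

/-! ### The action on reduced words -/

/-- The reduced words with given range and source. -/
abbrev Reduced (T : ∀ e, 𝒢.LeftTransversal e) (x z : 𝒢.UnitPt) :=
  {w : 𝒢.Word x z // w.IsReduced T}

/-- Left multiplication by an element, as a bijection between sets of reduced words. -/
noncomputable def actEquiv (T : ∀ e, 𝒢.LeftTransversal e) (z : 𝒢.UnitPt) (a : 𝒢.Arr x y) :
    Reduced T y z ≃ Reduced T x z where
  toFun w := ⟨act T a w.1, w.2.act a⟩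
  invFun w := ⟨act T a.inv w.1, w.2.act a.inv⟩
  left_inv w := Subtype.ext <| by
    change act T a.inv (act T a w.1) = w.1
    rw [← act_comp, Arr.inv_comp, act_id w.2]
  right_inv w := Subtype.ext <| by
    change act T a (act T a.inv w.1) = w.1
    rw [← act_comp, Arr.comp_inv, act_id w.2]

/-- Left multiplication by an edge, as a bijection between sets of reduced words. -/
noncomputable def edgeActEquiv (T : ∀ e, 𝒢.LeftTransversal e) (z : 𝒢.UnitPt) (e : E)
    (p : 𝒢.PhiRel e y x) : Reduced T x z ≃ Reduced T y z where
  toFun w := ⟨edgeAct T e p w.1, w.2.edgeAct p⟩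
  invFun w := ⟨edgeAct T (Γ.rev e) (PhiRel.symm 𝒢 p) w.1, w.2.edgeAct _⟩
  left_inv w := Subtype.ext (edgeAct_edgeAct (Γ.rev_rev e) p _ w.2)
  right_inv w := Subtype.ext (edgeAct_edgeAct rfl _ p w.2)

/-- The groupoid whose objects are the units `x`, and whose morphisms from `x` to `y` are the
bijections from the set of reduced words with range `y` to that of reduced words with range `x`,
all words having source `z`. The product of two bijections is their composite in the usual order,
so that the elements of `ℱ(𝒢(Γ))` can act by left multiplication. -/
def ReducedPerm (_ : ∀ e, 𝒢.LeftTransversal e) (_ : 𝒢.UnitPt) := 𝒢.UnitPt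

instance (T : ∀ e, 𝒢.LeftTransversal e) (z : 𝒢.UnitPt) : Groupoid (ReducedPerm T z) where
  Hom x y := Reduced T y z ≃ Reduced T x z
  id _ := Equiv.refl _
  comp f g := g.trans f
  inv f := f.symm
  id_comp _ := rfl
  comp_id _ := rfl
  assoc _ _ _ := rfl
  inv_comp f := f.self_trans_symm
  comp_inv f := f.symm_trans_self

/-- The action of the generators on reduced words. -/
noncomputable def genAct (T : ∀ e, 𝒢.LeftTransversal e) (z : 𝒢.UnitPt) :
    𝒢.UnitPt ⥤q ReducedPerm T z where
  obj x := x
  map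
    | .vert g => actEquiv T z (.mk g)
    | .edge e h => edgeActEquiv T z e h

/-- The action of `ℱ(𝒢(Γ))` on reduced words by left multiplication. -/
noncomputable def homAct (T : ∀ e, 𝒢.LeftTransversal e) (z : 𝒢.UnitPt) :
    𝒢.F ⥤ ReducedPerm T z :=
  CategoryTheory.Quotient.lift _ (Quiver.FreeGroupoid.lift (genAct T z)) <| by
    intro _ _ m₁ m₂ h
    cases h with
    | vert_id x =>
      refine Eq.trans ?_ (CategoryTheory.Functor.map_id _ _).symm
      exact Equiv.ext fun w => Subtype.ext (act_id w.2)
    | vert_comp g h =>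
      rw [Functor.map_comp]
      exact Equiv.ext fun w => Subtype.ext (act_comp (.mk g) (.mk h) w.1).symm
    | edge e g =>
      rw [Functor.map_comp, Functor.map_comp]
      exact Equiv.ext fun w => Subtype.ext (edgeAct_act_edgeAct (.map g) w.2)

/-- The product of a morphism of `ℱ(𝒢(Γ))` and a reduced word. -/
noncomputable def mulReduced (m : 𝒢.unit x ⟶ 𝒢.unit y) : Reduced T y z → Reduced T x z :=
  Equiv.toFun ((homAct T z).map m)

theorem mulReduced_comp (m : 𝒢.unit x ⟶ 𝒢.unit y) (m' : 𝒢.unit y ⟶ 𝒢.unit x')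
    (w : Reduced T x' z) : mulReduced (m ≫ m') w = mulReduced m (mulReduced m' w) := by
  rw [mulReduced, Functor.map_comp]
  rfl

theorem mulReduced_homOfArr (a : 𝒢.Arr x y) (w : Reduced T y z) :
    (mulReduced (homOfArr a) w).1 = act T a w.1 := by
  cases a
  rfl

theorem mulReduced_ofEdge (h : 𝒢.PhiRel e y x) (w : Reduced T x z) :
    (mulReduced (𝒢.ofEdge e h) w).1 = edgeAct T e h w.1 := rfl

/-- The product of the morphism represented by a reduced word `w` and the unit word is `w`. -/
theorem mulReduced_toHom {w : 𝒢.Word x z} (hw : w.IsReduced T) :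
    (mulReduced w.toHom (⟨ofArr (.id z), isReduced_ofArr _⟩ : Reduced T z z)).1 = w := by
  induction w using arr_induction with
  | ofArr a => rw [toHom_ofArr, mulReduced_homOfArr, act_ofArr, Arr.comp_id]
  | consArr e a h w ih =>
    obtain ⟨ha, hwe, hw⟩ := isReduced_consArr.1 hw
    rw [toHom_consArr, mulReduced_comp, mulReduced_comp, mulReduced_homOfArr, mulReduced_ofEdge,
      ih hw, edgeAct_of_firstAfter h hwe,
      act_consArr _ _ _ _ ⟨_, _, a, .id _, .id _, ha, .id h, rfl⟩, act_id hw]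

end Word

end GraphOfGroupoids

theorem theorem7p6 {V : Type uV} {E : Type uE} {Γ : SerreGraph V E}
    (𝒢 : GraphOfGroupoids.{uV, uE, v₁, u₁, v₂, u₂} Γ) (T : ∀ e, 𝒢.LeftTransversal e)
    (x y : 𝒢.UnitPt) (m : 𝒢.unit x ⟶ 𝒢.unit y) :
    ∃! w : 𝒢.Word x y, w.IsReduced T ∧ w.toHom = m := by
  obtain ⟨w, hw, rfl⟩ := GraphOfGroupoids.Word.exists_isReduced_toHom_eq T m
  refine ⟨w, ⟨hw, rfl⟩, fun w' ⟨hw', h⟩ => ?_⟩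
  rw [← GraphOfGroupoids.Word.mulReduced_toHom hw', h, GraphOfGroupoids.Word.mulReduced_toHom hw]
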